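/- A sum-network is a finite directed acyclic multigraph with a set of sources, none of which has an incoming edge, and a set of terminals, in which every source generates one message over an alphabet that is a finite abelian group $G$ and every terminal has to recover the sum of the messages of all the sources. For integers $k\ge 0$ and $n\ge 1$, a $(k,n)$ fractional coding solution over $G$ assigns to every edge $e$ an arbitrary (possibly nonlinear) function with values in $G^n$, which acts on the message in $G^k$ of the tail of $e$ if that tail is a source, and on the tuple of the vectors in $G^n$ carried by the edges entering the tail of $e$ otherwise, and to every terminal a function from the tuple of the vectors carried by its incoming edges to $G^k$, such that for every choice of messages $X_s\in G^k$ every terminal obtains $\sum_s X_s$, the sum over all sources $s$. A rate $r$ is achievable over $G$ if there is a $(k,n)$ fractional coding solution over $G$ with $k/n\ge r$, and the coding capacity over $G$ is the supremum of the rates achievable over $G$. Theorem. There exists a sum-network such that, over every finite abelian group $G$ with at least two elements, its coding capacity is $1$ and the rate $1$ is not achievable. In particular, its coding capacity is not achievable by any code over any such alphabet. -/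

import Mathlib

open scoped ENNReal

/-- A network: a finite directed acyclic multigraph with a set of sources, none of which has an
incoming edge, and a set of terminals. Each edge carries one alphabet symbol per use. -/
structure CodingNetwork where
  /-- nodes -/
  V : Type
  /-- edges; parallel edges are allowed -/
  E : Type
  [finite_V : Finite V]
  [finite_E : Finite E]
  /-- the node which an edge leaves -/
  tail : E → V
  /-- the node which an edge enters -/
  head : E → V
  /-- there is no directed cycle -/
  acyclic : ∀ v, ¬ Relation.TransGen (fun u w => ∃ e, tail e = u ∧ head e = w) v v
  sources : Finset V
  terminals : Finset V
  head_notMem_sources : ∀ e, head e ∉ sources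

namespace CodingNetwork

/-- The edges entering a node. -/
def In (N : CodingNetwork) (v : N.V) : Type := {e : N.E // N.head e = v}

/-- Edge `e'` feeds edge `e`: it enters the node which `e` leaves. -/
def Feeds (N : CodingNetwork) (e' e : N.E) : Prop := N.head e' = N.tail e

theorem wellFounded_feeds (N : CodingNetwork) : WellFounded N.Feeds := by
  have := N.finite_E
  have key : ∀ a b, Relation.TransGen N.Feeds a b →
      Relation.TransGen (fun u w => ∃ e, N.tail e = u ∧ N.head e = w) (N.tail a) (N.tail b) := by
    intro a b h
    induction h with
    | single h => exact .single ⟨a, rfl, h⟩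
    | @tail b c _ h ih => exact ih.tail ⟨b, rfl, h⟩
  have : IsTrans N.E (Relation.TransGen N.Feeds) := ⟨fun _ _ _ => Relation.TransGen.trans⟩
  have : Std.Irrefl (Relation.TransGen N.Feeds) := ⟨fun a h => N.acyclic _ (key a a h)⟩
  exact Subrelation.wf (fun h => Relation.TransGen.single h)
    (Finite.wellFounded_of_trans_of_irrefl (Relation.TransGen N.Feeds))

/-- A `(k, n)` fractional network code over the alphabet `A`, with arbitrary (possibly nonlinear)
edge functions and decoding functions: the message of a source is a `k`-tuple of symbols, and each
edge carries an `n`-tuple of symbols. -/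
structure Code (N : CodingNetwork) (A : Type*) (k n : ℕ) where
  /-- edge functions of the edges leaving a source -/
  sourceEnc : ∀ e : N.E, N.tail e ∈ N.sources → (Fin k → A) → (Fin n → A)
  /-- edge functions of the edges leaving any other node -/
  relayEnc : ∀ e : N.E, N.tail e ∉ N.sources → (N.In (N.tail e) → Fin n → A) → (Fin n → A)
  /-- decoding functions of the terminals -/
  dec : ∀ t ∈ N.terminals, (N.In t → Fin n → A) → (Fin k → A)

namespace Code

variable {N : CodingNetwork} {A : Type*} {k n : ℕ}

open Classical in
/-- The `n`-tuple which an edge carries when the sources have the messages `x`. -/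
noncomputable def carried (c : N.Code A k n) (x : N.sources → Fin k → A) : N.E → Fin n → A :=
  N.wellFounded_feeds.fix fun e Y =>
    if h : N.tail e ∈ N.sources then c.sourceEnc e h (x ⟨N.tail e, h⟩)
    else c.relayEnc e h fun e' => Y e'.1 e'.2

theorem carried_of_mem (c : N.Code A k n) (x : N.sources → Fin k → A) (e : N.E)
    (h : N.tail e ∈ N.sources) : c.carried x e = c.sourceEnc e h (x ⟨N.tail e, h⟩) := by
  rw [carried, WellFounded.fix_eq, dif_pos h]

theorem carried_of_notMem (c : N.Code A k n) (x : N.sources → Fin k → A) (e : N.E)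
    (h : N.tail e ∉ N.sources) :
    c.carried x e = c.relayEnc e h fun e' => c.carried x e'.1 := by
  rw [carried, WellFounded.fix_eq, dif_neg h]

/-- The `k`-tuple which a terminal recovers when the sources have the messages `x`. -/
noncomputable def recovered (c : N.Code A k n) (x : N.sources → Fin k → A)
    (t : N.V) (ht : t ∈ N.terminals) : Fin k → A :=
  c.dec t ht fun e => c.carried x e.1

end Code

/-- The sum-network on `N` has a `(k, n)` fractional coding solution over the abelian group `G`:
some `(k, n)` code lets every terminal recover the sum of the messages of all the sources,
whatever these messages are. -/
def HasSumSolution (N : CodingNetwork) (G : Type*) [AddCommGroup G] (k n : ℕ) : Prop :=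
  ∃ c : N.Code G k n, ∀ (x : N.sources → Fin k → G) (t : N.V) (ht : t ∈ N.terminals),
    c.recovered x t ht = ∑ s, x s

/-- The rate `r` is achievable for the sum-network on `N` over the alphabet `G`. -/
def SumAchievable (N : CodingNetwork) (G : Type*) [AddCommGroup G] (r : ℝ≥0∞) : Prop :=
  ∃ k n : ℕ, 0 < n ∧ N.HasSumSolution G k n ∧ r ≤ (k : ℝ≥0∞) / n

/-- The coding capacity, under the class of all network codes, of the sum-network on `N` over the
alphabet `G`: the supremum of the achievable rates. -/
noncomputable def sumCapacity (N : CodingNetwork) (G : Type*) [AddCommGroup G] : ℝ≥0∞ :=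
  sSup {r | N.SumAchievable G r}

end CodingNetwork

/-! Each `rest i` must determine the sum of all messages but the `i`-th, because `direct i` sees
only it and message `i`; so k ≤ n. If k = n, cardinality makes `rest i` equivalent to that sum.
Source `none` feeds only the `rest` channels, so its message can be chosen to make `rest i`
constant, and every other terminal seeing `rest i` must then decode message `i` from its remaining
inputs (`decode`).

Each copy thus yields a ternary operation and three binary ones, and their decoding conditions force
the operations to be sums in an abelian group, up to relabelling (`exists_addCommGroup_of_triple`).
In the copy with `diff` every element of this group has order at most 2, so the alphabet G^n has
even size; in the other, `pairs` excludes elements of order 2, so the size is odd. Hence rate 1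
fails.

For n = k + 1 there is room between |G|^k and |G|^(k+1) for a power of 2 and for an odd number. One
copy computes in a group (ℤ/2)^m, the other in a cyclic group of odd order, and the rates k/(k+1)
tend to 1. -/

namespace CodingNetwork

/-! ### Coding solutions as labellings of the edges -/

open Classical in
/-- A network has a `(k, n)` sum solution iff its edges can be labelled with functions of the
messages such that what enters a node determines what leaves it, and what enters a terminal
determines the sum. -/
theorem hasSumSolution_iff (N : CodingNetwork) {G : Type*} [AddCommGroup G] {k n : ℕ} :
    N.HasSumSolution G k n ↔ ∃ I : N.E → (N.sources → Fin k → G) → Fin n → G,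
      (∀ e (h : N.tail e ∈ N.sources) x x', x ⟨N.tail e, h⟩ = x' ⟨N.tail e, h⟩ → I e x = I e x') ∧
      (∀ e, N.tail e ∉ N.sources → ∀ x x',
        (∀ e', N.head e' = N.tail e → I e' x = I e' x') → I e x = I e x') ∧
      (∀ t ∈ N.terminals, ∀ x x', (∀ e', N.head e' = t → I e' x = I e' x') →
        ∑ s, x s = ∑ s, x' s) := by
  constructor
  · rintro ⟨c, hc⟩
    refine ⟨fun e x => c.carried x e, ?_, ?_, ?_⟩
    · intro e h x x' hx
      simp only [c.carried_of_mem _ e h, hx]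
    · intro e h x x' hx
      simp only [c.carried_of_notMem _ e h]
      congr 1
      funext e'
      exact hx e'.1 e'.2
    · intro t ht x x' hx
      rw [← hc x t ht, ← hc x' t ht]
      simp only [Code.recovered]
      congr 1
      funext e'
      exact hx e'.1 e'.2
  · rintro ⟨I, hS, hR, hT⟩
    let c : N.Code G k n :=
      { sourceEnc := fun e h m => I e (Function.update 0 ⟨N.tail e, h⟩ m)
        relayEnc := fun e _ Y =>
          -- Any messages consistent with the incoming tuple serve, by `hR`. The value 0 is given
          -- only to tuples that never occur.
          if h : ∃ x, Y = fun e' => I e'.1 x then I e h.choose else 0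
        dec := fun t _ Y =>
          if h : ∃ x : N.sources → Fin k → G, Y = fun e' => I e'.1 x then ∑ s, h.choose s else 0 }
    have hcar : ∀ x e, c.carried x e = I e x := by
      intro x e
      induction e using N.wellFounded_feeds.induction with
      | _ e ih =>
        by_cases h : N.tail e ∈ N.sources
        · rw [c.carried_of_mem x e h]
          exact hS e h _ _ (by simp)
        · rw [c.carried_of_notMem x e h]
          have hY : (fun e' : N.In (N.tail e) => c.carried x e'.1) = fun e' => I e'.1 x := by
            funext e'
            exact ih e'.1 e'.2
          have hex : ∃ x', (fun e' : N.In (N.tail e) => c.carried x e'.1) =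
              fun e' => I e'.1 x' := ⟨x, hY⟩
          have hch := hex.choose_spec
          refine (dif_pos hex).trans (hR e h _ _ fun e' he' => ?_)
          exact congrFun (hch.symm.trans hY) ⟨e', he'⟩
    refine ⟨c, fun x t ht => ?_⟩
    have hY : (fun e' : N.In t => c.carried x e'.1) = fun e' => I e'.1 x := by
      funext e'
      exact hcar x e'.1
    have hex : ∃ x', (fun e' : N.In t => c.carried x e'.1) = fun e' => I e'.1 x' := ⟨x, hY⟩
    have hch := hex.choose_spec
    refine (dif_pos hex).trans (hT t ht _ _ fun e' he' => ?_)
    exact congrFun (hch.symm.trans hY) ⟨e', he'⟩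

end CodingNetwork

/-! ### Wiring diagrams and their networks -/

/-- A wiring diagram with sources `S`, channels `W` and terminals `T`: the relation `feeds` tells
which sources and channels are seen by a channel or a terminal. -/
structure Wiring (S W T : Type) where
  /-- the source or channel is seen by the channel or terminal -/
  feeds : S ⊕ W → W ⊕ T → Prop
  /-- a height function which witnesses acyclicity -/
  rank : W ⊕ T → ℕ
  rank_lt : ∀ w q, feeds (.inr w) q → rank (.inl w) < rank q

namespace Wiring

variable {S W T : Type} [Fintype S] [Finite W] [Fintype T]

/-- The network of a wiring diagram. A channel `w` is an edge from `inr (inl w)` to `inl (inr w)`;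
every connection of the diagram is an edge as well. -/
def network (D : Wiring S W T) : CodingNetwork where
  V := (S ⊕ W) ⊕ (W ⊕ T)
  E := W ⊕ {c : (S ⊕ W) × (W ⊕ T) // D.feeds c.1 c.2}
  tail := Sum.elim (fun w => .inr (.inl w)) (fun c => .inl c.1.1)
  head := Sum.elim (fun w => .inl (.inr w)) (fun c => .inr c.1.2)
  acyclic := by
    -- Doubling the rank leaves room for the exit node of a channel strictly between its entry node
    -- and the nodes of higher rank.
    let height : (S ⊕ W) ⊕ (W ⊕ T) → ℕ :=
      Sum.elim (Sum.elim (fun _ => 0) fun w => 2 * D.rank (.inl w) + 2) fun q => 2 * D.rank q + 1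
    have key : ∀ u v, Relation.TransGen (fun u w => ∃ e : W ⊕ {c : (S ⊕ W) × (W ⊕ T) //
        D.feeds c.1 c.2}, Sum.elim (fun w => .inr (.inl w)) (fun c => .inl c.1.1) e = u ∧
          Sum.elim (fun w => .inl (.inr w)) (fun c => .inr c.1.2) e = w) u v →
        height u < height v := by
      have step : ∀ e : W ⊕ {c : (S ⊕ W) × (W ⊕ T) // D.feeds c.1 c.2},
          height (Sum.elim (fun w => .inr (.inl w)) (fun c => .inl c.1.1) e) <
          height (Sum.elim (fun w => .inl (.inr w)) (fun c => .inr c.1.2) e) := by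
        rintro (w | ⟨⟨s | w, q⟩, h⟩)
        · simp [height]
        · simp [height]
        · have := D.rank_lt w q h
          simp only [height, Sum.elim_inr, Sum.elim_inl]
          omega
      intro u v h
      induction h with
      | single h => obtain ⟨e, rfl, rfl⟩ := h; exact step e
      | tail _ h ih => obtain ⟨e, rfl, rfl⟩ := h; exact ih.trans (step e)
    exact fun v h => lt_irrefl _ (key v v h)
  sources := Finset.univ.map ⟨fun s => .inl (.inl s), fun _ _ h => by simpa using h⟩
  terminals := Finset.univ.map ⟨fun t => .inr (.inr t), fun _ _ h => by simpa using h⟩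
  head_notMem_sources := by
    rintro (w | c) h <;> obtain ⟨s, -, hs⟩ := Finset.mem_map.1 h <;> cases hs

theorem inl_inl_mem_sources (D : Wiring S W T) (s : S) :
    (.inl (.inl s) : D.network.V) ∈ D.network.sources :=
  Finset.mem_map_of_mem _ (Finset.mem_univ s)

theorem inl_inr_notMem_sources (D : Wiring S W T) (w : W) :
    (.inl (.inr w) : D.network.V) ∉ D.network.sources := by
  intro h
  obtain ⟨s, -, hs⟩ := Finset.mem_map.1 h
  cases hs

theorem inr_notMem_sources (D : Wiring S W T) (q : W ⊕ T) :
    (.inr q : D.network.V) ∉ D.network.sources := by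
  intro h
  obtain ⟨s, -, hs⟩ := Finset.mem_map.1 h
  cases hs

/-- The sources of a wiring diagram are the sources of its network. -/
noncomputable def sourceEquiv (D : Wiring S W T) : S ≃ D.network.sources :=
  Equiv.ofBijective (fun s => ⟨.inl (.inl s), D.inl_inl_mem_sources s⟩) <| by
    constructor
    · intro s s' h
      exact Sum.inl_injective (Sum.inl_injective (congrArg Subtype.val h))
    · rintro ⟨v, hv⟩
      obtain ⟨s, -, rfl⟩ := Finset.mem_map.1 hv
      exact ⟨s, rfl⟩

/-- Two choices of the messages give the same signal on a source or channel. -/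
def Same {M A : Type*} (val : W → (S → M) → A) (x x' : S → M) : S ⊕ W → Prop
  | .inl s => x s = x' s
  | .inr w => val w x = val w x'

/-- The channel values `val` solve the sum problem on a wiring diagram: every channel value is
determined by the signals seen by the channel, and every terminal sees enough for the sum. -/
structure Solves (D : Wiring S W T) {M A : Type*} [AddCommMonoid M] (val : W → (S → M) → A) :
    Prop where
  channel : ∀ w x x', (∀ p, D.feeds p (.inl w) → Same val x x' p) → val w x = val w x'
  terminal : ∀ t x x', (∀ p, D.feeds p (.inr t) → Same val x x' p) → ∑ s, x s = ∑ s, x' s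

/-- A connection edge has a single signal as its input, so it carries nothing beyond that signal and
can be ignored. -/
theorem exists_solves (D : Wiring S W T) {G : Type*} [AddCommGroup G] {k n : ℕ}
    (h : D.network.HasSumSolution G k n) :
    ∃ val : W → (S → Fin k → G) → Fin n → G, D.Solves val := by
  obtain ⟨I, hS, hR, hT⟩ := D.network.hasSumSolution_iff.1 h
  let σ := D.sourceEquiv
  have copy : ∀ (x x' : S → Fin k → G) (c : {c : (S ⊕ W) × (W ⊕ T) // D.feeds c.1 c.2}),
      Same (fun w x => I (.inl w) (x ∘ σ.symm)) x x' c.1.1 →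
      I (.inr c) (x ∘ σ.symm) = I (.inr c) (x' ∘ σ.symm) := by
    rintro x x' ⟨⟨s | w, q⟩, hc⟩ hx
    · refine hS (.inr ⟨(.inl s, q), hc⟩) (D.inl_inl_mem_sources s) _ _ ?_
      have : σ.symm ⟨.inl (.inl s), D.inl_inl_mem_sources s⟩ = s := σ.symm_apply_apply s
      change x (σ.symm _) = x' (σ.symm _)
      erw [this]
      exact hx
    · refine hR (.inr ⟨(.inr w, q), hc⟩) (D.inl_inr_notMem_sources w) _ _ ?_
      rintro (w' | c') he
      · obtain rfl : w' = w := by simpa [network] using he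
        exact hx
      · simp [network] at he
  refine ⟨fun w x => I (.inl w) (x ∘ σ.symm), ?_, ?_⟩
  · intro w x x' hx
    refine hR (.inl w) (D.inr_notMem_sources _) _ _ ?_
    rintro (w' | ⟨⟨p, q⟩, hc⟩) he
    · simp [network] at he
    · obtain rfl : q = .inl w := by simpa [network] using he
      exact copy _ _ _ (hx p hc)
  · intro t x x' hx
    have := hT (.inr (.inr t)) (Finset.mem_map_of_mem _ (Finset.mem_univ t))
      (x ∘ σ.symm) (x' ∘ σ.symm) ?_
    · simpa only [Function.comp_apply, Equiv.sum_comp σ.symm] using this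
    · rintro (w' | ⟨⟨p, q⟩, hc⟩) he
      · simp [network] at he
      · obtain rfl : q = .inr t := by simpa [network] using he
        exact copy _ _ _ (hx p hc)

/-- Connection edges repeat their signal; `emb` fits a source message into one edge. -/
theorem Solves.hasSumSolution {D : Wiring S W T} {G : Type*} [AddCommGroup G] {k n : ℕ}
    {val : W → (S → Fin k → G) → Fin n → G} (h : D.Solves val)
    {emb : (Fin k → G) → Fin n → G} (hemb : Function.Injective emb) :
    D.network.HasSumSolution G k n := by
  let σ := D.sourceEquiv
  let out : S ⊕ W → (S → Fin k → G) → Fin n → G := Sum.elim (fun s x => emb (x s)) val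
  have same : ∀ p x x', out p x = out p x' → Same val x x' p := by
    rintro (s | w) x x' hx
    · exact hemb hx
    · exact hx
  refine D.network.hasSumSolution_iff.2
    ⟨fun e x => Sum.elim (fun w => val w (x ∘ σ)) (fun c => out c.1.1 (x ∘ σ)) e, ?_, ?_, ?_⟩
  · rintro (w | ⟨⟨s | w, q⟩, hc⟩) he x x' hx
    · exact absurd he (D.inr_notMem_sources _)
    · exact congrArg emb hx
    · exact absurd he (D.inl_inr_notMem_sources _)
  · rintro (w | ⟨⟨s | w, q⟩, hc⟩) he x x' hx
    · exact h.channel w _ _ fun p hp => same _ _ _ (hx (.inr ⟨(p, .inl w), hp⟩) rfl)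
    · exact absurd (D.inl_inl_mem_sources s) he
    · exact hx (.inl w) rfl
  · intro t ht x x' hx
    obtain ⟨t, -, rfl⟩ := Finset.mem_map.1 ht
    have := h.terminal t (x ∘ σ) (x' ∘ σ)
      fun p hp => same _ _ _ (hx (.inr ⟨(p, .inr t), hp⟩) rfl)
    simpa only [Function.comp_apply, Equiv.sum_comp σ] using this

end Wiring

/-! ### Ternary operations that are forced to be group sums -/

section Quasigroups

variable {A : Type*} [Finite A]

/-- If a pair value `x p q` together with the value `w p q r`, bijective in `q` and `r`, determines
`r`, then `x` and `w` have the same fibres in `(p, q)`. -/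
theorem pair_eq_iff {w : A → A → A → A} {x : A → A → A}
    (hq : ∀ p r, Function.Injective fun q => w p q r)
    (hr : ∀ p q, Function.Injective fun r => w p q r)
    (hx : ∀ p q r p' q' r', x p q = x p' q' → w p q r = w p' q' r' → r = r')
    (p q p' q' r : A) : x p q = x p' q' ↔ w p q r = w p' q' r := by
  have key : ∀ p q p' q', x p q = x p' q' → ∀ r, w p q r = w p' q' r := by
    intro p q p' q' h r
    obtain ⟨r', hr'⟩ := (Finite.injective_iff_surjective.1 (hr p' q')) (w p q r)
    obtain rfl : r = r' := hx p q r p' q' r' h (Eq.symm hr' :)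
    exact Eq.symm hr'
  refine ⟨fun h => key _ _ _ _ h r, fun h => ?_⟩
  -- By finiteness `x p` attains every value, so `x p' q'` equals some `x p q₁`; the first
  -- implication then forces `q₁ = q`.
  have hinj : Function.Injective (x p) := fun q₁ q₂ h => hq p r (key p q₁ p q₂ h r)
  obtain ⟨q₁, hq₁⟩ := (Finite.injective_iff_surjective.1 hinj) (x p' q')
  have : q₁ = q := hq p r ((key _ _ _ _ hq₁ r).trans h.symm)
  rw [← hq₁, this]

/-- A three-variable operation which factors through each pair of variables, as in
`hx`, `hy` and `hz`, is isotopic to the threefold sum in an abelian group. -/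
theorem exists_addCommGroup_of_triple [Nonempty A] {w : A → A → A → A} {x y z : A → A → A}
    (hx : ∀ a b c a' b' c', x a b = x a' b' → w a b c = w a' b' c' → c = c')
    (hy : ∀ a b c a' b' c', y a c = y a' c' → w a b c = w a' b' c' → b = b')
    (hz : ∀ a b c a' b' c', z b c = z b' c' → w a b c = w a' b' c' → a = a') :
    ∃ (_ : AddCommGroup A) (α β γ : A ≃ A), (∀ a b c, w a b c = α a + β b + γ c) ∧
      (∀ a b a' b', x a b = x a' b' ↔ α a + β b = α a' + β b') ∧
      (∀ a c a' c', y a c = y a' c' ↔ α a + γ c = α a' + γ c') ∧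
      (∀ b c b' c', z b c = z b' c' ↔ β b + γ c = β b' + γ c') := by
  obtain ⟨o⟩ := ‹Nonempty A›
  have ia : ∀ b c, Function.Injective fun a => w a b c := fun b c a a' h => hz _ _ _ _ _ _ rfl h
  have ib : ∀ a c, Function.Injective fun b => w a b c := fun a c b b' h => hy _ _ _ _ _ _ rfl h
  have ic : ∀ a b, Function.Injective fun c => w a b c := fun a b c c' h => hx _ _ _ _ _ _ rfl h
  have kx := pair_eq_iff ib ic hx
  have ky := pair_eq_iff (w := fun a c b => w a b c) ic ib
    fun a c b a' c' b' => hy a b c a' b' c'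
  have kz := pair_eq_iff (w := fun b c a => w a b c) (fun b a => ic a b) (fun b c => ia b c)
    fun b c a b' c' a' => hz a b c a' b' c'
  let α := Equiv.ofBijective _ (Finite.injective_iff_bijective.1 (ia o o))
  let β := Equiv.ofBijective _ (Finite.injective_iff_bijective.1 (ib o o))
  let γ := Equiv.ofBijective _ (Finite.injective_iff_bijective.1 (ic o o))
  have hα : ∀ p, w (α.symm p) o o = p := α.apply_symm_apply
  have hβ : ∀ p, w o (β.symm p) o = p := β.apply_symm_apply
  have hβo : β.symm (w o o o) = o := β.symm_apply_apply o
  have hαo : α.symm (w o o o) = o := α.symm_apply_apply o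
  -- The candidate addition, with zero `w o o o`. Grouping the three variables of `w` in different
  -- ways gives its commutativity and associativity.
  let m : A → A → A := fun p q => w (α.symm p) (β.symm q) o
  have zero_m : ∀ p, m (w o o o) p = p := fun p => by simp only [m, hαo, hβ]
  have m_zero : ∀ p, m p (w o o o) = p := fun p => by simp only [m, hβo, hα]
  have viaX : ∀ a b c, w a b c = w (α.symm (w a b o)) o c := fun a b c =>
    (kx _ _ _ _ c).1 ((kx _ _ _ _ o).2 (hα _).symm)
  have viaY : ∀ a b c, w a b c = m (w a o c) (β b) := by
    intro a b c
    have := (ky _ _ _ _ b).1 ((ky a c (α.symm (w a o c)) o o).2 (hα _).symm)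
    simpa only [m, Equiv.symm_apply_apply] using this
  have viaZ : ∀ a b c, w a b c = m (α a) (w o b c) := by
    intro a b c
    have := (kz _ _ _ _ a).1 ((kz b c (β.symm (w o b c)) o o).2 (hβ _).symm)
    simpa only [m, Equiv.symm_apply_apply] using this
  have hbc : ∀ b c, w o b c = m (γ c) (β b) := fun b c => viaY o b c
  have hab : ∀ a b, w a b o = m (α a) (β b) := fun a b => viaZ a b o
  have hac : ∀ a c, w a o c = m (α a) (γ c) := fun a c => viaZ a o c
  have hac' : ∀ a c, w a o c = m (γ c) (α a) := by
    intro a c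
    have h1 := viaX o (β.symm (α a)) c
    rw [hβ, Equiv.symm_apply_apply] at h1
    rw [← h1, hbc, Equiv.apply_symm_apply]
  have comm : ∀ p q, m p q = m q p := by
    intro p q
    have := (hac (α.symm p) (γ.symm q)).symm.trans (hac' _ _)
    simpa only [Equiv.apply_symm_apply] using this
  -- Both sides evaluate `w` at one triple: grouped as (a, c) with b by `viaY`, and as a with (b, c)
  -- by `viaZ`.
  have assoc : ∀ p q r, m (m p q) r = m p (m q r) := by
    intro p q r
    have h1 := viaY (α.symm p) (β.symm r) (γ.symm q)
    have h2 := viaZ (α.symm p) (β.symm r) (γ.symm q)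
    rw [hac] at h1
    rw [hbc] at h2
    simp only [Equiv.apply_symm_apply] at h1 h2
    exact h1.symm.trans h2
  have inv : ∀ p, ∃ q, m q p = w o o o := fun p =>
    ⟨α ((Equiv.ofBijective _ (Finite.injective_iff_bijective.1 (ia (β.symm p) o))).symm (w o o o)),
      by
        simp only [m, Equiv.symm_apply_apply]
        exact Equiv.ofBijective_apply_symm_apply (fun a => w a (β.symm p) o) _ _⟩
  choose neg hneg using inv
  let _ : Add A := ⟨m⟩
  let _ : Zero A := ⟨w o o o⟩
  let _ : Neg A := ⟨neg⟩
  let grp : AddCommGroup A :=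
    { AddGroup.ofLeftAxioms (G := A) assoc zero_m hneg with add_comm := comm }
  refine ⟨grp, α, β, γ, ?_, ?_, ?_, ?_⟩
  · intro a b c
    rw [viaY, hac]
    exact add_right_comm (α a) (γ c) (β b)
  · intro a b a' b'
    rw [kx _ _ _ _ o, hab, hab]
    rfl
  · intro a c a' c'
    rw [ky _ _ _ _ o, hac, hac]
    rfl
  · intro b c b' c'
    rw [kz _ _ _ _ o, hbc, hbc, comm (γ c), comm (γ c')]
    rfl

/-- If moreover some function of `x` and `y` determines `c` together with `b`, and `a` together with
`w`, then the alphabet has even size. -/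
theorem even_card_of_triple [Nontrivial A] {w u : A → A → A → A} {x y z : A → A → A}
    (hx : ∀ a b c a' b' c', x a b = x a' b' → w a b c = w a' b' c' → c = c')
    (hy : ∀ a b c a' b' c', y a c = y a' c' → w a b c = w a' b' c' → b = b')
    (hz : ∀ a b c a' b' c', z b c = z b' c' → w a b c = w a' b' c' → a = a')
    (hu : ∀ a b c a' b' c', x a b = x a' b' → y a c = y a' c' → u a b c = u a' b' c')
    (hub : ∀ a b c a' c', u a b c = u a' b c' → c = c')
    (huw : ∀ a b c a' b' c', u a b c = u a' b' c' → w a b c = w a' b' c' → a = a') :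
    2 ∣ Nat.card A := by
  obtain ⟨_, α, β, γ, hw, kx, ky, -⟩ := exists_addCommGroup_of_triple hx hy hz
  obtain ⟨t, ht⟩ := exists_ne (0 : A)
  -- For fixed `a` and `b`, `u` is a bijection in `c`; decoding `c` from `u` and `b` across
  -- different first arguments makes `u` independent of `a`.
  have hua : ∀ a a' b c, u a b c = u a' b c := by
    intro a a' b c
    obtain ⟨c', hc'⟩ := (Finite.injective_iff_surjective.1 fun c c' => hub a b c a c') (u a' b c)
    rw [← hc', hub _ _ _ _ _ hc']
  -- In group coordinates (0, 0, 0) and (-t, t, t) agree on `x` and `y`, hence on `u`. Changing -t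
  -- to -2t preserves `u` and restores the sum 0, so `huw` gives 2t = 0.
  have h1 : u (α.symm 0) (β.symm 0) (γ.symm 0) = u (α.symm (-t)) (β.symm t) (γ.symm t) :=
    hu _ _ _ _ _ _ ((kx _ _ _ _).2 (by simp)) ((ky _ _ _ _).2 (by simp))
  have h2 := huw _ _ _ _ _ _ (h1.trans (hua _ (α.symm (-(2 • t))) _ _))
    (by simp [hw, two_nsmul, add_assoc])
  have h3 : 2 • t = 0 := by simpa using h2
  have := Fact.mk Nat.prime_two
  rw [← addOrderOf_eq_prime h3 ht]
  exact addOrderOf_dvd_natCard t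

/-- If moreover `x`, `y` and `z` determine `a`, then the alphabet has odd size. -/
theorem not_even_card_of_triple [Nonempty A] {w : A → A → A → A} {x y z : A → A → A}
    (hx : ∀ a b c a' b' c', x a b = x a' b' → w a b c = w a' b' c' → c = c')
    (hy : ∀ a b c a' b' c', y a c = y a' c' → w a b c = w a' b' c' → b = b')
    (hz : ∀ a b c a' b' c', z b c = z b' c' → w a b c = w a' b' c' → a = a')
    (hxyz : ∀ a b c a' b' c', x a b = x a' b' → y a c = y a' c' → z b c = z b' c' → a = a') :
    ¬ 2 ∣ Nat.card A := by
  obtain ⟨_, α, β, γ, -, kx, ky, kz⟩ := exists_addCommGroup_of_triple hx hy hz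
  intro h2
  have := Fact.mk Nat.prime_two
  obtain ⟨t, ht⟩ := exists_prime_addOrderOf_dvd_card' 2 h2
  have htt : t + t = 0 := by rw [← two_nsmul, ← ht, addOrderOf_nsmul_eq_zero]
  -- For t of order 2 the triples (0, 0, 0) and (t, t, t) have the same pairwise sums.
  have h0 : α.symm 0 = α.symm t := hxyz _ (β.symm 0) (γ.symm 0) _ (β.symm t) (γ.symm t)
    ((kx _ _ _ _).2 (by simp [htt])) ((ky _ _ _ _).2 (by simp [htt]))
    ((kz _ _ _ _).2 (by simp [htt]))
  rw [← α.symm.injective h0] at ht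
  simp at ht

end Quasigroups

/-! ### The network -/

namespace UnachievableSum

/-- The channels of the network. Apart from the bottlenecks `rest i`, which carry the sum of all
messages but the `i`-th one, there are two copies `full j`, `pair j i` of a network for three
messages, the first of which is extended by the channel `diff`. -/
inductive Chan
  | rest (i : Fin 3)
  | full (j : Bool)
  | pair (j : Bool) (i : Fin 3)
  | diff
  deriving Fintype

/-- The terminals of the network. -/
inductive Term
  | direct (i : Fin 3)
  | core (j : Bool) (i : Fin 3)
  | diffOne
  | diffFull
  | pairs
  deriving Fintype

open Chan Term

/-- What a channel or a terminal sees. The sources are `some i` for `i : Fin 3` and `none`. -/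
def inputs : Chan ⊕ Term → Set (Option (Fin 3) ⊕ Chan)
  | .inl (rest i) => {p | ∃ s, s ≠ some i ∧ p = .inl s}
  | .inl (full _) => {p | ∃ l, p = .inl (some l)}
  | .inl (pair _ i) => {p | ∃ l, l ≠ i ∧ p = .inl (some l)}
  | .inl diff => {.inr (pair false 1), .inr (pair false 2)}
  | .inr (direct i) => {.inl (some i), .inr (rest i)}
  | .inr (core j i) => {.inr (full j), .inr (pair j i), .inr (rest i)}
  | .inr diffOne => {.inr diff, .inl (some 1), .inr (rest 2)}
  | .inr diffFull => {.inr diff, .inr (full false), .inr (rest 0)}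
  | .inr pairs => {.inr (pair true 0), .inr (pair true 1), .inr (pair true 2), .inr (rest 0)}

/-- The height of a channel or terminal. -/
def height : Chan ⊕ Term → ℕ
  | .inl diff => 1
  | .inl _ => 0
  | .inr _ => 2

/-- The wiring diagram of the sum-network whose capacity is not achievable. -/
def wiring : Wiring (Option (Fin 3)) Chan Term where
  feeds p q := p ∈ inputs q
  rank := height
  rank_lt := by
    rintro w ((i | j | ⟨j, i⟩ | _) | t) h
    · simp [inputs] at h
    · simp [inputs] at h
    · simp [inputs] at h
    · obtain rfl | rfl : w = pair false 1 ∨ w = pair false 2 := by simpa [inputs] using h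
      all_goals simp [height]
    · cases w <;> simp [height]

/-! ### Rate 1 is impossible -/

section Necessity

variable {M A : Type*} [AddCommGroup M] {val : Chan → (Option (Fin 3) → M) → A}

/-- Message `i` of `x'` can be replaced by that of `x` without affecting `rest i`; the terminal
`direct i` then cannot tell the two choices apart. -/
theorem sum_sub_eq_of_rest_eq (h : wiring.Solves val) (i : Fin 3) {x x' : Option (Fin 3) → M}
    (hx : val (rest i) x = val (rest i) x') :
    ∑ s, x s - x (some i) = ∑ s, x' s - x' (some i) := by
  have h1 : val (rest i) x' = val (rest i) (Function.update x' (some i) (x (some i))) := by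
    refine h.channel _ _ _ ?_
    rintro _ ⟨s, hs, rfl⟩
    simp [Wiring.Same, hs]
  have h2 := h.terminal (direct i) x (Function.update x' (some i) (x (some i))) <| by
    rintro _ (rfl | rfl)
    · simp [Wiring.Same]
    · exact hx.trans h1
  rw [h2, Finset.sum_update_of_mem (Finset.mem_univ _), add_sub_cancel_left,
    ← Finset.erase_eq, Finset.sum_erase_eq_sub (Finset.mem_univ _)]

theorem injective_rest (h : wiring.Solves val) (i : Fin 3) :
    Function.Injective fun d : M => val (rest i) (Function.update 0 none d) := by
  intro d d' hd
  simpa using sum_sub_eq_of_rest_eq h i hd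

/-- With equal cardinalities `injective_rest` is a bijection, so every value of `rest i` is already
attained with all messages but that of `none` zero, where that message is the sum. -/
theorem rest_eq_of_sum_sub_eq [Finite A] (h : wiring.Solves val) (hc : Nat.card A = Nat.card M)
    (i : Fin 3) {x x' : Option (Fin 3) → M}
    (hx : ∑ s, x s - x (some i) = ∑ s, x' s - x' (some i)) :
    val (rest i) x = val (rest i) x' := by
  have hb : Function.Bijective fun d : M => val (rest i) (Function.update 0 none d) :=
    (Nat.bijective_iff_injective_and_card _).2 ⟨injective_rest h i, hc.symm⟩
  have key : ∀ x, val (rest i) x =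
      val (rest i) (Function.update 0 none (∑ s, x s - x (some i))) := by
    intro x
    obtain ⟨d, hd⟩ := hb.2 (val (rest i) x)
    have := sum_sub_eq_of_rest_eq h i hd
    simp only [Finset.sum_update_of_mem (Finset.mem_univ _), ne_eq, reduceCtorEq,
      not_false_eq_true, Function.update_of_ne, Pi.zero_apply, Finset.sum_const_zero, add_zero,
      sub_zero] at this
    rw [← this]
    exact hd.symm
  rw [key x, hx, ← key x']

/-- The messages `m i` at `some i` and `d` at `none`. -/
def messages (m : Fin 3 → M) (d : M) (s : Option (Fin 3)) : M := s.elim d m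

/-- A terminal which sees `rest i` can decode the `i`-th message from its other inputs. -/
theorem decode [Finite A] (h : wiring.Solves val) (hc : Nat.card A = Nat.card M) (t : Term)
    (i : Fin 3) {m m' : Fin 3 → M}
    (hm : ∀ d d', ∀ p ∈ inputs (.inr t), p ≠ .inr (rest i) →
      Wiring.Same val (messages m d) (messages m' d') p) : m i = m' i := by
  -- This message at `none` makes the sum of all messages but the `i`-th zero, and so the total sum
  -- equal to `m i`.
  have hr : ∑ s, messages m (m i - ∑ l, m l) s - messages m (m i - ∑ l, m l) (some i) =
      ∑ s, messages m' (m' i - ∑ l, m' l) s - messages m' (m' i - ∑ l, m' l) (some i) := by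
    simp [messages, Fintype.sum_option]
  have := h.terminal t (messages m (m i - ∑ l, m l)) (messages m' (m' i - ∑ l, m' l)) <| by
    intro p hp
    by_cases hpi : p = .inr (rest i)
    · subst hpi
      exact rest_eq_of_sum_sub_eq h hc i hr
    · exact hm _ _ p hp hpi
  simpa [messages, Fintype.sum_option] using this

theorem full_eq (h : wiring.Solves val) (j : Bool) (m : Fin 3 → M) (d : M) :
    val (full j) (messages m d) = val (full j) (messages m 0) :=
  h.channel _ _ _ <| by
    rintro _ ⟨l, rfl⟩
    rfl

theorem pair_eq (h : wiring.Solves val) (j : Bool) (i : Fin 3) {m m' : Fin 3 → M}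
    (hm : ∀ l, l ≠ i → m l = m' l) (d d' : M) :
    val (pair j i) (messages m d) = val (pair j i) (messages m' d') :=
  h.channel _ _ _ <| by
    rintro _ ⟨l, hl, rfl⟩
    exact hm l hl

theorem diff_eq (h : wiring.Solves val) {m m' : Fin 3 → M} (d d' : M)
    (h1 : val (pair false 1) (messages m 0) = val (pair false 1) (messages m' 0))
    (h2 : val (pair false 2) (messages m 0) = val (pair false 2) (messages m' 0)) :
    val diff (messages m d) = val diff (messages m' d') := by
  refine h.channel _ _ _ ?_
  rintro _ (rfl | rfl)
  · exact (pair_eq h _ _ (fun _ _ => rfl) _ _).trans (h1.trans (pair_eq h _ _ (fun _ _ => rfl) _ _))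
  · exact (pair_eq h _ _ (fun _ _ => rfl) _ _).trans (h2.trans (pair_eq h _ _ (fun _ _ => rfl) _ _))

theorem decode_core [Finite A] (h : wiring.Solves val) (hc : Nat.card A = Nat.card M) (j : Bool)
    (i : Fin 3) {m m' : Fin 3 → M}
    (hp : val (pair j i) (messages m 0) = val (pair j i) (messages m' 0))
    (hf : val (full j) (messages m 0) = val (full j) (messages m' 0)) : m i = m' i := by
  refine decode h hc (core j i) i fun d d' p hmem hi => ?_
  rcases hmem with (rfl | rfl | rfl)
  · exact (full_eq h _ _ _).trans (hf.trans (full_eq h _ _ _).symm)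
  · exact (pair_eq h _ _ (fun _ _ => rfl) _ _).trans
      (hp.trans (pair_eq h _ _ (fun _ _ => rfl) _ _))
  · exact absurd rfl hi

/-- The copy `false` forces the size of `M` to be even and the copy `true` forces it to be odd. -/
theorem not_solves {M : Type*} [AddCommGroup M] [Finite M] [Nontrivial M]
    {val : Chan → (Option (Fin 3) → M) → M} : ¬ wiring.Solves val := by
  intro h
  let w (j : Bool) (a b c : M) : M := val (full j) (messages ![a, b, c] 0)
  let x (j : Bool) (a b : M) : M := val (pair j 2) (messages ![a, b, 0] 0)
  let y (j : Bool) (a c : M) : M := val (pair j 1) (messages ![a, 0, c] 0)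
  let z (j : Bool) (b c : M) : M := val (pair j 0) (messages ![0, b, c] 0)
  let u (a b c : M) : M := val diff (messages ![a, b, c] 0)
  have ex : ∀ j a b c, x j a b = val (pair j 2) (messages ![a, b, c] 0) := fun j a b c =>
    pair_eq h _ _ (by intro l hl; fin_cases l <;> simp_all) _ _
  have ey : ∀ j a b c, y j a c = val (pair j 1) (messages ![a, b, c] 0) := fun j a b c =>
    pair_eq h _ _ (by intro l hl; fin_cases l <;> simp_all) _ _
  have ez : ∀ j a b c, z j b c = val (pair j 0) (messages ![a, b, c] 0) := fun j a b c =>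
    pair_eq h _ _ (by intro l hl; fin_cases l <;> simp_all) _ _
  have hx : ∀ j a b c a' b' c', x j a b = x j a' b' → w j a b c = w j a' b' c' → c = c' := by
    intro j a b c a' b' c' h1 h2
    rw [ex j a b c, ex j a' b' c'] at h1
    exact decode_core h rfl j 2 h1 h2
  have hy : ∀ j a b c a' b' c', y j a c = y j a' c' → w j a b c = w j a' b' c' → b = b' := by
    intro j a b c a' b' c' h1 h2
    rw [ey j a b c, ey j a' b' c'] at h1
    exact decode_core h rfl j 1 h1 h2
  have hz : ∀ j a b c a' b' c', z j b c = z j b' c' → w j a b c = w j a' b' c' → a = a' := by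
    intro j a b c a' b' c' h1 h2
    rw [ez j a b c, ez j a' b' c'] at h1
    exact decode_core h rfl j 0 h1 h2
  have hu0 : ∀ m d, val diff (messages m d) = val diff (messages m 0) :=
    fun m d => diff_eq h _ _ rfl rfl
  refine not_even_card_of_triple (hx true) (hy true) (hz true) ?_ <|
    even_card_of_triple (u := u) (hx false) (hy false) (hz false) ?_ ?_ ?_
  · intro a b c a' b' c' h2 h1 h0
    rw [ex _ a b c, ex _ a' b' c'] at h2
    rw [ey _ a b c, ey _ a' b' c'] at h1
    rw [ez _ a b c, ez _ a' b' c'] at h0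
    refine decode (m := ![a, b, c]) (m' := ![a', b', c']) h rfl pairs 0 fun d d' p hp hi => ?_
    have self : ∀ i (m : Fin 3 → M) (d d' : M),
        val (pair true i) (messages m d) = val (pair true i) (messages m d') :=
      fun i m d d' => pair_eq h _ _ (fun _ _ => rfl) _ _
    rcases hp with (rfl | rfl | rfl | rfl)
    · exact (self _ _ _ _).trans (h0.trans (self _ _ _ _))
    · exact (self _ _ _ _).trans (h1.trans (self _ _ _ _))
    · exact (self _ _ _ _).trans (h2.trans (self _ _ _ _))
    · exact absurd rfl hi
  · intro a b c a' b' c' h2 h1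
    rw [ex _ a b c, ex _ a' b' c'] at h2
    rw [ey _ a b c, ey _ a' b' c'] at h1
    exact diff_eq h _ _ h1 h2
  · intro a b c a' c' hd
    refine decode (m := ![a, b, c]) (m' := ![a', b, c']) h rfl diffOne 2 fun d d' p hp hi => ?_
    rcases hp with (rfl | rfl | rfl)
    · exact (hu0 _ _).trans (hd.trans (hu0 _ _).symm)
    · rfl
    · exact absurd rfl hi
  · intro a b c a' b' c' hd hf
    refine decode (m := ![a, b, c]) (m' := ![a', b', c']) h rfl diffFull 0 fun d d' p hp hi => ?_
    rcases hp with (rfl | rfl | rfl)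
    · exact (hu0 _ _).trans (hd.trans (hu0 _ _).symm)
    · exact (full_eq h _ _ _).trans (hf.trans (full_eq h _ _ _).symm)
    · exact absurd rfl hi

end Necessity

/-! ### Codes of rate k/(k+1) -/

section Sufficiency

/-- The network has a sum solution if messages can be embedded into edge values via a group of
exponent two and via a group in which doubling is injective. -/
theorem exists_solves {M A B C : Type*} [AddCommGroup M] [AddCommGroup B] [AddCommGroup C]
    (hB : ∀ b : B, b + b = 0) (hC : ∀ c c' : C, c + c = c' + c' → c = c')
    {ι : M → B} (hι : Function.Injective ι) {κ : B → A} (hκ : Function.Injective κ)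
    {ι' : M → C} (hι' : Function.Injective ι') {κ' : C → A} (hκ' : Function.Injective κ')
    {emb : M → A} (hemb : Function.Injective emb) :
    ∃ val : Chan → (Option (Fin 3) → M) → A, wiring.Solves val := by
  let val : Chan → (Option (Fin 3) → M) → A
    | rest i, x => emb (∑ s, x s - x (some i))
    | full false, x => κ (∑ l, ι (x (some l)))
    | full true, x => κ' (∑ l, ι' (x (some l)))
    | pair false i, x => κ (∑ l, ι (x (some l)) - ι (x (some i)))
    | pair true i, x => κ' (∑ l, ι' (x (some l)) - ι' (x (some i)))
    | diff, x => κ (∑ l, ι (x (some l)) - ι (x (some 0)))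
  have finish : ∀ i (x x' : Option (Fin 3) → M), val (rest i) x = val (rest i) x' →
      x (some i) = x' (some i) → ∑ s, x s = ∑ s, x' s := by
    intro i x x' h1 h2
    have h3 := hemb h1
    rw [h2] at h3
    exact sub_left_injective h3
  refine ⟨val, ?_, ?_⟩
  · rintro (i | j | ⟨j, i⟩ | _) x x' h
    · refine congrArg emb ?_
      rw [← Finset.sum_erase_eq_sub (Finset.mem_univ _),
        ← Finset.sum_erase_eq_sub (Finset.mem_univ _)]
      exact Finset.sum_congr rfl fun s hs => h (.inl s) ⟨s, Finset.ne_of_mem_erase hs, rfl⟩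
    · have h' : ∀ l, x (some l) = x' (some l) := fun l => h (.inl (some l)) ⟨l, rfl⟩
      cases j <;> simp only [val, h']
    · have h' : ∀ l, l ≠ i → x (some l) = x' (some l) :=
        fun l hl => h (.inl (some l)) ⟨l, hl, rfl⟩
      cases j
      · refine congrArg κ ?_
        rw [← Finset.sum_erase_eq_sub (Finset.mem_univ _),
          ← Finset.sum_erase_eq_sub (Finset.mem_univ _)]
        exact Finset.sum_congr rfl fun l hl => by rw [h' l (Finset.ne_of_mem_erase hl)]
      · refine congrArg κ' ?_
        rw [← Finset.sum_erase_eq_sub (Finset.mem_univ _),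
          ← Finset.sum_erase_eq_sub (Finset.mem_univ _)]
        exact Finset.sum_congr rfl fun l hl => by rw [h' l (Finset.ne_of_mem_erase hl)]
    · have h1 := hκ (h (.inr (pair false 1)) (.inl rfl))
      have h2 := hκ (h (.inr (pair false 2)) (.inr rfl))
      refine congrArg κ ?_
      simp only [Fin.sum_univ_three] at h1 h2 ⊢
      -- In exponent two, `a` cancels from the sum of a + c and a + b, leaving the value b + c of
      -- `diff`.
      have e : ∀ a b c : B, a + b + c - a = (a + b + c - b) + (a + b + c - c) - (a + a) := by
        intro a b c
        abel
      rw [e, e, h1, h2, hB, hB]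
  · rintro (i | ⟨j, i⟩ | _ | _ | _) x x' h
    · exact finish i x x' (h (.inr (rest i)) (.inr rfl)) (h (.inl (some i)) (.inl rfl))
    · refine finish i x x' (h (.inr (rest i)) (.inr (.inr rfl))) ?_
      have h1 := h (.inr (full j)) (.inl rfl)
      have h2 := h (.inr (pair j i)) (.inr (.inl rfl))
      cases j
      · have h2' := hκ h2
        rw [hκ h1] at h2'
        exact hι (sub_right_injective h2')
      · have h2' := hκ' h2
        rw [hκ' h1] at h2'
        exact hι' (sub_right_injective h2')
    · refine finish 2 x x' (h (.inr (rest 2)) (.inr (.inr rfl))) ?_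
      have h1 := hκ (h (.inr diff) (.inl rfl))
      have h2 : x (some 1) = x' (some 1) := h (.inl (some 1)) (.inr (.inl rfl))
      simp only [Fin.sum_univ_three, h2, add_assoc, add_sub_cancel_left] at h1
      exact hι (add_right_injective _ h1)
    · refine finish 0 x x' (h (.inr (rest 0)) (.inr (.inr rfl))) ?_
      have h1 := hκ (h (.inr diff) (.inl rfl))
      rw [hκ (h (.inr (full false)) (.inr (.inl rfl)))] at h1
      exact hι (sub_right_injective h1)
    · refine finish 0 x x' (h (.inr (rest 0)) (.inr (.inr (.inr rfl)))) ?_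
      have h0 := hκ' (h (.inr (pair true 0)) (.inl rfl))
      have h1 := hκ' (h (.inr (pair true 1)) (.inr (.inl rfl)))
      have h2 := hκ' (h (.inr (pair true 2)) (.inr (.inr (.inl rfl))))
      simp only [Fin.sum_univ_three] at h0 h1 h2
      -- The three pair sums determine 2a, hence a where doubling is injective.
      have e : ∀ a b c : C, a + a = (a + b + c - b) + (a + b + c - c) - (a + b + c - a) := by
        intro a b c
        abel
      refine hι' (hC _ _ ?_)
      rw [e _ (ι' (x (some 1))) (ι' (x (some 2))), h0, h1, h2, ← e]

theorem exists_injective_of_card_le {α β : Type*} [Finite α] [Finite β]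
    (h : Nat.card α ≤ Nat.card β) : ∃ f : α → β, Function.Injective f := by
  have := Fintype.ofFinite α
  have := Fintype.ofFinite β
  rw [Nat.card_eq_fintype_card, Nat.card_eq_fintype_card] at h
  obtain ⟨f⟩ := Function.Embedding.nonempty_of_card_le h
  exact ⟨f, f.injective⟩

/-- The two bounds differ by a factor of at least 2, so the largest power of 2 below the upper one
is at least the lower one. -/
theorem exists_two_pow_between {N : ℕ} (hN : 2 ≤ N) (k : ℕ) :
    ∃ m, N ^ k ≤ 2 ^ m ∧ 2 ^ m ≤ N ^ (k + 1) := by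
  refine ⟨Nat.log 2 (N ^ (k + 1)), ?_, Nat.pow_log_le_self 2 (by positivity)⟩
  have h1 := Nat.lt_pow_succ_log_self (b := 2) (by norm_num) (N ^ (k + 1))
  have h2 : N ^ k * 2 ≤ N ^ (k + 1) := by
    rw [pow_succ]
    gcongr
  rw [Nat.succ_eq_add_one, pow_succ 2] at h1
  omega

theorem exists_odd_between {N : ℕ} (hN : 2 ≤ N) (k : ℕ) :
    ∃ r, N ^ k ≤ 2 * r + 1 ∧ 2 * r + 1 ≤ N ^ (k + 1) := by
  -- This makes 2r + 1 the least odd number that is at least N^k.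
  refine ⟨N ^ k / 2, by omega, ?_⟩
  have h1 : 0 < N ^ k := by positivity
  have h2 : N ^ k * 2 ≤ N ^ (k + 1) := by
    rw [pow_succ]
    gcongr
  omega

theorem hasSumSolution_succ (G : Type*) [AddCommGroup G] [Finite G] [Nontrivial G] (k : ℕ) :
    wiring.network.HasSumSolution G k (k + 1) := by
  have hN : 2 ≤ Nat.card G := Finite.one_lt_card
  have hcard : ∀ n, Nat.card (Fin n → G) = Nat.card G ^ n := fun n => by simp [Nat.card_fun]
  obtain ⟨m, hm, hm'⟩ := exists_two_pow_between hN k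
  obtain ⟨r, hr, hr'⟩ := exists_odd_between hN k
  have hB : Nat.card (Fin m → ZMod 2) = 2 ^ m := by simp
  have hC : Nat.card (ZMod (2 * r + 1)) = 2 * r + 1 := Nat.card_zmod _
  rw [← hcard, ← hB] at hm hm'
  rw [← hcard, ← hC] at hr hr'
  obtain ⟨ι, hι⟩ := exists_injective_of_card_le hm
  obtain ⟨κ, hκ⟩ := exists_injective_of_card_le hm'
  obtain ⟨ι', hι'⟩ := exists_injective_of_card_le hr
  obtain ⟨κ', hκ'⟩ := exists_injective_of_card_le hr'
  obtain ⟨val, h⟩ := exists_solves (fun b => funext fun _ => CharTwo.add_self_eq_zero _)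
    -- Modulo 2r + 1, doubling is inverted by multiplication by -r.
    (fun c c' hc => by
      have h0 : (2 * r + 1 : ZMod (2 * r + 1)) = 0 := by
        exact_mod_cast ZMod.natCast_self (2 * r + 1)
      linear_combination (c - c') * h0 - r * hc) hι hκ hι' hκ' (hκ.comp hι)
  exact h.hasSumSolution (hκ.comp hι)

end Sufficiency

/-! ### The capacity and its unachievability -/

theorem le_of_hasSumSolution {G : Type*} [AddCommGroup G] [Finite G] [Nontrivial G] {k n : ℕ}
    (h : wiring.network.HasSumSolution G k n) : k ≤ n := by
  obtain ⟨val, hval⟩ := wiring.exists_solves h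
  have := Nat.card_le_card_of_injective _ (injective_rest hval 0)
  simp only [Nat.card_fun, Nat.card_eq_fintype_card, Fintype.card_fin] at this
  exact (Nat.pow_le_pow_iff_right Finite.one_lt_card).1 this

theorem not_hasSumSolution_self {G : Type*} [AddCommGroup G] [Finite G] [Nontrivial G] {n : ℕ}
    (hn : 0 < n) : ¬ wiring.network.HasSumSolution G n n := by
  intro h
  have : Nonempty (Fin n) := ⟨⟨0, hn⟩⟩
  obtain ⟨val, hval⟩ := wiring.exists_solves h
  exact not_solves hval

open scoped ENNReal in
theorem sumCapacity_eq_one (G : Type*) [AddCommGroup G] [Finite G] [Nontrivial G] :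
    wiring.network.sumCapacity G = 1 := by
  refine le_antisymm (sSup_le ?_) (le_of_forall_lt fun a ha => ?_)
  · rintro r ⟨k, n, hn, h, hr⟩
    refine hr.trans (ENNReal.div_le_of_le_mul ?_)
    rw [one_mul]
    exact_mod_cast le_of_hasSumSolution h
  · have hlim : Filter.Tendsto (fun k : ℕ => (k : ℝ≥0∞) / ((k + 1 : ℕ) : ℝ≥0∞)) Filter.atTop
        (nhds 1) := by
      have := ENNReal.tendsto_ofReal (tendsto_natCast_div_add_atTop (1 : ℝ))
      rw [ENNReal.ofReal_one] at this
      refine this.congr fun k => ?_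
      rw [ENNReal.ofReal_div_of_pos (by positivity), ENNReal.ofReal_natCast]
      congr 1
      exact_mod_cast ENNReal.ofReal_natCast (k + 1)
    obtain ⟨k, hk⟩ := (hlim.eventually_const_lt ha).exists
    exact hk.trans_le (le_sSup ⟨k, k + 1, k.succ_pos, hasSumSolution_succ G k, le_rfl⟩)

end UnachievableSum

theorem mainTheorem8 :
    ∃ N : CodingNetwork, ∀ (G : Type*) [AddCommGroup G] [Finite G] [Nontrivial G],
      N.sumCapacity G = 1 ∧ ¬ N.SumAchievable G (N.sumCapacity G) := by
  refine ⟨UnachievableSum.wiring.network, fun G _ _ _ => ?_⟩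
  have hcap := UnachievableSum.sumCapacity_eq_one G
  refine ⟨hcap, ?_⟩
  rw [hcap]
  rintro ⟨k, n, hn, h, hr⟩
  have hn0 : (n : ENNReal) ≠ 0 := by exact_mod_cast hn.ne'
  rw [ENNReal.le_div_iff_mul_le (.inl hn0) (.inl (ENNReal.natCast_ne_top n)), one_mul] at hr
  -- A code of rate at least 1 has k = n, which is the case excluded by counting and parity.
  obtain rfl : k = n := le_antisymm (UnachievableSum.le_of_hasSumSolution h) (by exact_mod_cast hr)
  exact UnachievableSum.not_hasSumSolution_self hn h
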